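/- Let $X$ be a real Banach space with topological dual $X^*$, and let $\Phi : X \to \mathbb{R}\cup\{+\infty\}$ be a proper, lower semicontinuous convex function. For $x \in X$ let $\partial\Phi(x) := \{x^*\in X^* \mid \langle x^*, u-x\rangle \le \Phi(u)-\Phi(x)\ \text{for all } u\in X\}$ if $\Phi(x)<+\infty$, and $\partial\Phi(x):=\emptyset$ otherwise. Then for every $\bar x \in \operatorname{dom}\Phi := \{x\in X \mid \Phi(x)<+\infty\}$, the normal cone at $\bar x$ to the sublevel set $[\Phi\le\Phi(\bar x)] := \{x\in X \mid \Phi(x)\le\Phi(\bar x)\}$, $$\mathrm{N}_{[\Phi\le\Phi(\bar x)]}(\bar x) := \{x^*\in X^* \mid \langle x^*, x-\bar x\rangle\le 0 \ \text{ for all } x\in[\Phi\le\Phi(\bar x)]\},$$ satisfies $$\mathrm{N}_{[\Phi\le\Phi(\bar x)]}(\bar x) = w^*\text{-}\limsup_{\substack{x\to\bar x,\ \mu\ge 0\\ \mu(\Phi(x)-\Phi(\bar x))\to 0\\ \mu\langle\cdot,\,x-\bar x\rangle\to 0}} \mu\,\partial\Phi(x).$$ Here the right-hand side is the Painlevé–Kuratowski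 upper limit in the weak* topology: the set of all $\xi\in X^*$ such that for every weak* neighbourhood $W$ of $\xi$ and every $\varepsilon>0$ there exist $x\in X$, $\mu\ge 0$ and $x^*\in\partial\Phi(x)$ with $\|x-\bar x\|<\varepsilon$, $|\mu(\Phi(x)-\Phi(\bar x))|<\varepsilon$, $|\mu\langle x^*,x-\bar x\rangle|<\varepsilon$ and $\mu x^*\in W$. Equivalently, it is the set of all weak* limits of nets $(\mu_i x_i^*)$ with $\mu_i\ge 0$, $x_i^*\in\partial\Phi(x_i)$, $x_i\to\bar x$ in norm, $\mu_i(\Phi(x_i)-\Phi(\bar x))\to 0$ and $\mu_i\langle x_i^*,x_i-\bar x\rangle\to 0$. -/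

import Mathlib

open Filter Topology

namespace ConvexSublevel

/-- The Painlevé–Kuratowski upper limit of a multifunction `M : U ⇉ V` along a filter `l` on `U`:
all `v` such that every neighbourhood of `v` meets `M u` for some `u` in each member of `l`.
(Equivalently, `v` is the limit of a net `v i ∈ M (u i)` with `u i` converging along `l`.) -/
def upperLimit {U V : Type*} [TopologicalSpace V] (l : Filter U) (M : U → Set V) : Set V :=
  {v | ∀ W ∈ 𝓝 v, ∀ Z ∈ l, ∃ u ∈ Z, (M u ∩ W).Nonempty}

section

variable {X : Type*} [NormedAddCommGroup X] [NormedSpace ℝ X]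

/-- `Φ : X → ℝ ∪ {+∞}` is proper, convex (it has a convex epigraph) and lower semicontinuous. -/
structure IsGammaZero (Φ : X → EReal) : Prop where
  ne_bot : ∀ x, Φ x ≠ ⊥
  exists_ne_top : ∃ x, Φ x ≠ ⊤
  convex_epigraph : Convex ℝ {p : X × ℝ | Φ p.1 ≤ (p.2 : EReal)}
  lsc : LowerSemicontinuous Φ

/-- The effective domain. -/
def effDomain (Φ : X → EReal) : Set X := {x | Φ x < ⊤}

/-- The sublevel set `[Φ ≤ c]`. -/
def sublevel (Φ : X → EReal) (c : EReal) : Set X := {x | Φ x ≤ c}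

/-- The normal cone to `S` at `xbar`, a subset of the dual space with its weak* topology. -/
def normalCone (S : Set X) (xbar : X) : Set (WeakDual ℝ X) :=
  {ξ | ∀ x ∈ S, ξ (x - xbar) ≤ 0}

/-- The Fenchel subdifferential; it is empty outside the effective domain. -/
def subdiff (Φ : X → EReal) (x : X) : Set (WeakDual ℝ X) :=
  {ξ | x ∈ effDomain Φ ∧ ∀ u, ((ξ (u - x) : ℝ) : EReal) ≤ Φ u - Φ x}

/-- The mode of convergence of the triples `(x, μ, ξ)`, with `μ ≥ 0` and `ξ ∈ ∂Φ(x)`: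
`x → xbar` in norm, `μ (Φ x - Φ xbar) → 0` and `μ ⟨ξ, x - xbar⟩ → 0`.
It is used for `xbar` in the effective domain; as `x` lies there too when `∂Φ(x)` is nonempty,
the two values under `EReal.toReal` are finite. -/
noncomputable def approach (Φ : X → EReal) (xbar : X) : Filter (X × ℝ × WeakDual ℝ X) :=
  comap (fun p => p.1) (𝓝 xbar) ⊓
  comap (fun p => p.2.1 * ((Φ p.1).toReal - (Φ xbar).toReal)) (𝓝 0) ⊓
  comap (fun p => p.2.1 * p.2.2 (p.1 - xbar)) (𝓝 0) ⊓
  𝓟 {p | 0 ≤ p.2.1 ∧ p.2.2 ∈ subdiff Φ p.1}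

end

end ConvexSublevel

/-! The upper limit consists of normals because, for `Φ u ≤ Φ xbar`, the subgradient inequality
gives `μ ⟨x*, u - xbar⟩ ≤ μ (Φ xbar - Φ x) + μ ⟨x*, x - xbar⟩`, and both terms on the right tend to
0.

Conversely, let `ξ` be normal and `α < ξ v`. On the ray from `xbar` along `v`, some `μ (Φ - Φ xbar)`
with `μ > 0` dominates `t α - ε` (`exists_pos_mul_le_on_ray`). Separating a segment from the
epigraph turns this into an approximate subgradient of `μ Φ` at `xbar` with value at `v` above any
given `β < α`. Over all `μ > 0` these functionals form a convex set which no vector separates from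
`ξ`, so `ξ` lies in its weak* closure. The Brøndsted–Rockafellar theorem, obtained from Ekeland's
principle and a sandwich theorem, replaces each by an exact subgradient at a nearby point, with both
scalar products small. -/

/-! ### Ekeland's variational principle. -/

/-- **Ekeland's variational principle**, for a perturbation `q` which dominates the distance
along the induced order. -/
theorem exists_ekeland_point {Y : Type*} [PseudoMetricSpace Y] [CompleteSpace Y]
    {F : Y → ℝ} {q : Y → Y → ℝ} {C m : ℝ} (hF : Continuous F) (hq : ∀ z, Continuous (q z))
    (hq_nonneg : ∀ x y, 0 ≤ q x y) (hq_self : ∀ x, q x x = 0)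
    (hq_tri : ∀ x y z, q x z ≤ q x y + q y z)
    (hdist : ∀ x y, F y + q x y ≤ F x → dist x y ≤ C * (F x - F y))
    (hm : ∀ y, m ≤ F y) (z₀ : Y) :
    ∃ z, F z + q z₀ z ≤ F z₀ ∧ ∀ w, F z ≤ F w + q z w := by
  have step : ∀ (n : ℕ) (z : Y), ∃ w, F w + q z w ≤ F z ∧
      ∀ y, F y + q z y ≤ F z → F w ≤ F y + (1 / 2 : ℝ) ^ n := by
    intro n z
    let A : Set ℝ := F '' {y | F y + q z y ≤ F z}
    have hA : A.Nonempty := ⟨F z, z, by simp [hq_self], rfl⟩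
    have hbdd : BddBelow A := ⟨m, by rintro _ ⟨y, -, rfl⟩; exact hm y⟩
    obtain ⟨_, ⟨w, hw, rfl⟩, hlt⟩ := exists_lt_of_csInf_lt hA
      (lt_add_of_pos_right (sInf A) (by positivity : (0 : ℝ) < (1 / 2) ^ n))
    exact ⟨w, hw, fun y hy => hlt.le.trans (by gcongr; exact csInf_le hbdd ⟨y, hy, rfl⟩)⟩
  choose g hg hg_min using step
  let z : ℕ → Y := fun n => Nat.rec z₀ (fun n w => g n w) n
  have hz_succ : ∀ n, z (n + 1) = g n (z n) := fun n => rfl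
  have hmono : ∀ n k, F (z (n + k)) + q (z n) (z (n + k)) ≤ F (z n) := by
    intro n k
    induction k with
    | zero => simp [hq_self]
    | succ k ih =>
      have h1 := hg (n + k) (z (n + k))
      rw [← hz_succ] at h1
      have h2 := hq_tri (z n) (z (n + k)) (z (n + k + 1))
      rw [← add_assoc]
      linarith
  have hanti : Antitone (F ∘ z) := antitone_nat_of_succ_le fun n => by
    have := hmono n 1
    have := hq_nonneg (z n) (z (n + 1))
    simp only [Function.comp_apply]
    linarith
  have hlim := tendsto_atTop_ciInf hanti ⟨m, by rintro _ ⟨n, rfl⟩; exact hm _⟩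
  set l := ⨅ i, (F ∘ z) i
  have hcauchy : CauchySeq z := by
    refine cauchySeq_of_le_tendsto_0' (fun n => |C| * ((F ∘ z) n - l)) (fun n k hnk => ?_) ?_
    · obtain ⟨k, rfl⟩ := Nat.exists_eq_add_of_le hnk
      have h1 : l ≤ F (z (n + k)) := hanti.le_of_tendsto hlim _
      have h2 : F (z (n + k)) ≤ F (z n) := hanti hnk
      calc dist (z n) (z (n + k)) ≤ C * (F (z n) - F (z (n + k))) := hdist _ _ (hmono n k)
        _ ≤ |C| * (F (z n) - F (z (n + k))) := by gcongr; exact le_abs_self C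
        _ ≤ |C| * (F (z n) - l) := by gcongr
    · simpa using (hlim.sub_const l).const_mul |C|
  obtain ⟨w, hw⟩ := cauchySeq_tendsto_of_complete hcauchy
  have hFw : F w = l := tendsto_nhds_unique ((hF.tendsto w).comp hw) hlim
  have hle : ∀ n, F w + q (z n) w ≤ F (z n) := by
    intro n
    have h := (((hF.add (hq (z n))).tendsto w).comp hw).comp (tendsto_add_atTop_nat n)
    refine le_of_tendsto h (Eventually.of_forall fun k => ?_)
    simpa [add_comm k n] using hmono n k
  refine ⟨w, hle 0, fun y => ?_⟩
  by_contra! hy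
  -- By the triangle inequality `y` competes at every stage, so in the limit `F w ≤ F y`.
  have key : ∀ n, F (z (n + 1)) ≤ F y + (1 / 2 : ℝ) ^ n := fun n =>
    hg_min n (z n) y (by linarith [hq_tri (z n) w y, hle n])
  have h1 : Tendsto (fun n : ℕ => F y + (1 / 2 : ℝ) ^ n) atTop (𝓝 (F y + 0)) :=
    (tendsto_pow_atTop_nhds_zero_of_lt_one (by norm_num) (by norm_num)).const_add _
  have h2 := le_of_tendsto_of_tendsto (hlim.comp (tendsto_add_atTop_nat 1)) h1
    (Eventually.of_forall key)
  linarith [hq_nonneg w y]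

/-! ### Separation and approximate subgradients. -/

section

variable {X : Type*} [NormedAddCommGroup X] [NormedSpace ℝ X]

/-- Every continuous linear functional on `X × ℝ` is `(w, s) ↦ g w + τ * s`. -/
theorem StrongDual.exists_eq_add_mul (f : StrongDual ℝ (X × ℝ)) :
    ∃ (g : X →L[ℝ] ℝ) (τ : ℝ), ∀ w s, f (w, s) = g w + τ * s := by
  refine ⟨f.comp (ContinuousLinearMap.inl ℝ X ℝ), f (0, 1), fun w s => ?_⟩
  have : ((w, s) : X × ℝ) = (w, 0) + s • (0, 1) := by simp
  rw [this, map_add, map_smul]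
  simp [mul_comm]

/-- Sandwich theorem: an affine function between `-p` and the lower boundary of a convex set
lying above the graph of `-p` and through the origin, for `p` continuous sublinear. -/
theorem Convex.exists_dual_le_seminorm {D : Set (X × ℝ)} (hD : Convex ℝ D) (h0 : (0, 0) ∈ D)
    (p : Seminorm ℝ X) (hp : Continuous p) (hDp : ∀ w s, (w, s) ∈ D → 0 ≤ s + p w) :
    ∃ g : X →L[ℝ] ℝ, (∀ w, g w ≤ p w) ∧ ∀ w s, (w, s) ∈ D → 0 ≤ s + g w := by
  let O : Set (X × ℝ) := {z | z.2 + p z.1 < 0}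
  have hO : IsOpen O := isOpen_lt (by fun_prop) continuous_const
  have hOc : Convex ℝ O := by
    rintro ⟨w, s⟩ hw ⟨w', s'⟩ hw' a b ha hb hab
    simp only [O, Set.mem_ofPred_eq, Prod.smul_mk, Prod.mk_add_mk, smul_eq_mul] at hw hw' ⊢
    have h1 : p (a • w + b • w') ≤ a * p w + b * p w' := by
      refine (map_add_le_add p _ _).trans ?_
      simp [map_smul_eq_mul, abs_of_nonneg ha, abs_of_nonneg hb]
    rcases ha.eq_or_lt with rfl | ha
    · obtain rfl : b = 1 := by linarith
      simpa using hw'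
    · nlinarith
  have hdisj : Disjoint O D := Set.disjoint_left.2 fun z hz hzD =>
    (hDp z.1 z.2 hzD).not_gt hz
  obtain ⟨f, c, hfO, hfD⟩ := geometric_hahn_banach_open hOc hO hD hdisj
  obtain ⟨g, τ, hf⟩ := StrongDual.exists_eq_add_mul f
  have hc0 : c ≤ 0 := by simpa [hf] using hfD _ h0
  -- The separating hyperplane is not vertical: `O` contains a point strictly below the origin.
  have hτ : 0 < τ := by
    have := hfO (0, -1) (by simp [O])
    rw [hf] at this
    simp at this
    linarith
  have hlim : ∀ w, g w ≤ τ * p w := by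
    intro w
    refine le_of_forall_pos_lt_add fun δ hδ => ?_
    have := hfO (w, -p w - δ / τ) (by simp only [O, Set.mem_ofPred_eq]; have := div_pos hδ hτ; linarith)
    rw [hf] at this
    have h2 : τ * (δ / τ) = δ := by field_simp
    nlinarith
  have hc : 0 ≤ c := by
    refine le_of_forall_pos_lt_add fun δ hδ => ?_
    have := hfO (0, - (δ / τ)) (by simp [O]; positivity)
    rw [hf] at this
    have h2 : τ * (δ / τ) = δ := by field_simp
    simp at this
    linarith
  refine ⟨τ⁻¹ • g, fun w => ?_, fun w s hw => ?_⟩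
  · have := hlim w
    simp only [smul_apply, smul_eq_mul]
    rw [inv_mul_le_iff₀ hτ]; exact this
  · have h1 := hc.trans (hfD _ hw)
    rw [hf] at h1
    have : s + (τ⁻¹ • g) w = τ⁻¹ * (g w + τ * s) := by
      simp; field_simp; ring
    rw [this]; positivity

/-- The **Brøndsted–Rockafellar theorem** in Borwein's form, on a closed convex epigraph. -/
theorem exists_subgradient_near_of_approx_subgradient [CompleteSpace X]
    {E : Set (X × ℝ)} (hE : IsClosed E) (hEc : Convex ℝ E) {x₀ : X} {r₀ μ κ : ℝ}
    (h₀ : (x₀, r₀) ∈ E) (hμ : 0 < μ) (hκ : 0 < κ) (η : X →L[ℝ] ℝ)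
    (hη : ∀ u r, (u, r) ∈ E → η (u - x₀) ≤ μ * (r - r₀) + κ ^ 2) :
    ∃ (x : X) (r : ℝ) (ζ : X →L[ℝ] ℝ), (x, r) ∈ E ∧
      (∀ u s, (u, s) ∈ E → ζ (u - x) ≤ μ * (s - r)) ∧
      ‖x - x₀‖ ≤ κ ∧ |μ * (r - r₀)| ≤ κ + κ ^ 2 ∧ |ζ (x - x₀)| ≤ κ + κ ^ 2 ∧
      ∀ w, |ζ w - η w| ≤ κ * (‖w‖ + |η w|) := by
  -- The term `|η w|` is Borwein's device: it controls `η (x - x₀)` with no bound on the norm of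
  -- `η`.
  let p : X → ℝ := fun w => ‖w‖ + |η w|
  have hp : Continuous p := by fun_prop
  have hp_add : ∀ a b, p (a + b) ≤ p a + p b := fun a b => by
    have h1 := norm_add_le a b
    have h2 := abs_add_le (η a) (η b)
    simp only [p, map_add]; linarith
  have hp_nn : ∀ a, 0 ≤ p a := fun a => by positivity
  have hp_neg : ∀ a, p (-a) = p a := fun a => by simp [p]
  -- On the epigraph the objective is continuous, although `Φ` is only lower semicontinuous.
  let F : E → ℝ := fun z => μ * z.1.2 - η z.1.1
  let q : E → E → ℝ := fun z w => κ * p (w.1.1 - z.1.1)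
  have : CompleteSpace E := hE.completeSpace_coe
  obtain ⟨⟨⟨x, r⟩, hxE⟩, hx1, hx2⟩ := exists_ekeland_point (F := F) (q := q)
      (C := κ⁻¹ + μ⁻¹ * (1 + κ⁻¹)) (m := μ * r₀ - η x₀ - κ ^ 2)
      (by fun_prop) (fun z => by fun_prop)
      (fun x y => mul_nonneg hκ.le (hp_nn _)) (fun x => by simp [q, p])
      (fun x y z => by
        have := hp_add (z.1.1 - y.1.1) (y.1.1 - x.1.1)
        rw [sub_add_sub_cancel] at this
        simp only [q]; nlinarith)
      -- `q` ignores the vertical coordinate; its displacement is recovered from the drop of `F` and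
      -- the bound on `η`.
      (fun x y h => by
        have hp1 : κ * p (y.1.1 - x.1.1) ≤ F x - F y := le_sub_iff_add_le'.2 h
        have hΔ : 0 ≤ F x - F y := (mul_nonneg hκ.le (hp_nn _)).trans hp1
        have hp2 : p (y.1.1 - x.1.1) ≤ κ⁻¹ * (F x - F y) := by
          rwa [le_inv_mul_iff₀ hκ]
        have hn : ‖y.1.1 - x.1.1‖ ≤ κ⁻¹ * (F x - F y) := le_trans (by simp [p]) hp2
        have ha : |η (y.1.1 - x.1.1)| ≤ κ⁻¹ * (F x - F y) := le_trans (by simp [p]) hp2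
        have hr : |x.1.2 - y.1.2| ≤ μ⁻¹ * (1 + κ⁻¹) * (F x - F y) := by
          rw [mul_assoc, le_inv_mul_iff₀ hμ, ← abs_of_pos hμ, ← abs_mul]
          have e : μ * (x.1.2 - y.1.2) = (F x - F y) - η (y.1.1 - x.1.1) := by
            simp only [F, map_sub]; ring
          rw [e, abs_le]
          rw [abs_le] at ha
          constructor <;> linarith
        rw [Subtype.dist_eq, Prod.dist_eq, add_mul]
        refine max_le ?_ ?_
        · rw [dist_comm, dist_eq_norm]
          have := (abs_nonneg _).trans hr
          linarith
        · rw [Real.dist_eq]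
          have := (norm_nonneg _).trans hn
          linarith)
      (fun y => by
        have := hη y.1.1 y.1.2 y.2
        simp only [map_sub] at this
        simp only [F]; linarith)
      ⟨(x₀, r₀), h₀⟩
  simp only [F, q] at hx1
  have hx2' : ∀ u s, (u, s) ∈ E → μ * r - η x ≤ μ * s - η u + κ * p (u - x) :=
    fun u s h => hx2 ⟨(u, s), h⟩
  have hηx := hη x r hxE
  have hpx : p (x - x₀) ≤ κ := by
    simp only [map_sub] at hηx
    have : κ * p (x - x₀) ≤ κ * κ := by nlinarith
    exact le_of_mul_le_mul_left this hκ
  have hn : ‖x - x₀‖ ≤ κ := le_trans (by simp [p]) hpx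
  have ha : |η (x - x₀)| ≤ κ := le_trans (by simp [p]) hpx
  let P : Seminorm ℝ X := Seminorm.of (fun w => κ * p w)
    (fun a b => by have := hp_add a b; nlinarith)
    (fun c a => by simp [p, norm_smul, abs_mul]; ring)
  have hP : ∀ w, P w = κ * p w := fun w => rfl
  -- The epigraph moved to put `(x, r)` at the origin, scaled by `μ` and tilted by `η`. Ekeland
  -- minimality says that it lies above `-κ p`.
  let D : Set (X × ℝ) := {z | ∃ s, (x + z.1, s) ∈ E ∧ z.2 = μ * (s - r) - η z.1}
  have hD : Convex ℝ D := by
    rintro ⟨w, t⟩ ⟨s, hs, h⟩ ⟨w', t'⟩ ⟨s', hs', h'⟩ a b ha hb hab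
    refine ⟨a * s + b * s', ?_, ?_⟩
    · convert hEc hs hs' ha hb hab using 1
      ext
      · simp only [Prod.fst_add, Prod.smul_fst, smul_add]
        rw [add_add_add_comm, ← add_smul, hab, one_smul]
      · simp
    · simp only at h h'
      simp only [Prod.fst_add, Prod.smul_fst, Prod.snd_add, Prod.smul_snd, map_add, map_smul,
        smul_eq_mul, h, h']
      linear_combination (- μ * r) * hab
  obtain ⟨g, hg1, hg2⟩ := hD.exists_dual_le_seminorm (p := P) ⟨r, by simpa using hxE, by simp⟩
    (by change Continuous fun w => κ * p w; fun_prop) (by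
      rintro w t ⟨s, hs, h⟩
      obtain rfl : t = μ * (s - r) - η w := h
      have := hx2' _ _ hs
      simp only [map_add, add_sub_cancel_left] at this
      simp only [hP]; linarith)
  have hg : ∀ w, |g w| ≤ κ * p w := fun w =>
    abs_le.2 ⟨by have := hg1 (-w); rw [hP, hp_neg, map_neg] at this; linarith, hg1 w⟩
  refine ⟨x, r, η - g, hxE, fun u s hs => ?_, hn, ?_, ?_, fun w => by simpa using hg w⟩
  · have := hg2 (u - x) (μ * (s - r) - η (u - x)) ⟨s, by simpa using hs, rfl⟩
    simp only [sub_apply]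
    linarith
  · have h1 : μ * (r - r₀) ≤ η (x - x₀) := by
      have := mul_nonneg hκ.le (hp_nn (x - x₀))
      rw [map_sub]; linarith
    rw [abs_le] at ha ⊢
    constructor <;> nlinarith
  · have h1 := hg (x - x₀)
    have h2 : κ * p (x - x₀) ≤ κ * κ := by gcongr
    have h3 := abs_sub (η (x - x₀)) (g (x - x₀))
    simp only [sub_apply]
    nlinarith

/-- If a closed convex set lies above the ray through `(x₀, r₀)` with direction `(v, α / μ)`, up to
a vertical tolerance, then there is an approximate subgradient whose value at `v` almost
exceeds `α`. -/
theorem exists_approx_subgradient_lt {E : Set (X × ℝ)} (hE : IsClosed E) (hEc : Convex ℝ E)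
    {x₀ v : X} {r₀ μ ε α β : ℝ} (h₀ : (x₀, r₀) ∈ E) (hμ : 0 < μ) (hε : 0 < ε) (hβ : β < α)
    (hray : ∀ t r, 0 ≤ t → (x₀ + t • v, r) ∈ E → t * α - ε ≤ μ * (r - r₀)) :
    ∃ η : X →L[ℝ] ℝ, β < η v ∧ ∀ u r, (u, r) ∈ E → η (u - x₀) ≤ μ * (r - r₀) + 2 * ε := by
  -- Over the length `T`, lowering the slope from `α` to `β` costs exactly the drop `2 * ε`. The
  -- segment `PQ` is compact, so it can be separated strictly.
  let T : ℝ := 2 * ε / (α - β)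
  have hT : 0 < T := div_pos (by linarith) (by linarith)
  have hTβ : T * α - 2 * ε = T * β := by
    have : α - β ≠ 0 := by linarith
    simp only [T]; field_simp; ring
  let P : X × ℝ := (x₀, r₀ - 2 * ε / μ)
  let Q : X × ℝ := (x₀ + T • v, r₀ + (T * α - 2 * ε) / μ)
  have hcomp : IsCompact (segment ℝ P Q) := by
    rw [← convexHull_pair]; exact (Set.toFinite {P, Q}).isCompact_convexHull (𝕜 := ℝ)
  have hdisj : Disjoint (segment ℝ P Q) E := by
    rw [Set.disjoint_left]
    rintro _ ⟨a, b, ha, hb, hab, rfl⟩ hmem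
    have h1 : a • P + b • Q = (x₀ + (b * T) • v, r₀ + (b * T * α - 2 * ε) / μ) := by
      obtain rfl : a = 1 - b := by linarith
      ext
      · simp only [P, Q, Prod.fst_add, Prod.smul_fst, smul_add, smul_smul]
        module
      · simp only [P, Q, Prod.snd_add, Prod.smul_snd, smul_eq_mul]
        ring
    rw [h1] at hmem
    have := hray _ _ (mul_nonneg hb hT.le) hmem
    rw [add_sub_cancel_left, mul_div_cancel₀ _ hμ.ne'] at this
    linarith
  obtain ⟨f, c, d, hfs, hcd, hfE⟩ :=
    geometric_hahn_banach_compact_closed (convex_segment P Q) hcomp hEc hE hdisj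
  obtain ⟨g, τ, hf⟩ := StrongDual.exists_eq_add_mul f
  have hP := hfs P (left_mem_segment ℝ P Q)
  have hQ := hfs Q (right_mem_segment ℝ P Q)
  have hx := hfE _ h₀
  simp only [P, Q, hf, map_add, map_smul, smul_eq_mul] at hP hQ hx
  have hτ : 0 < τ := by
    have h1 : 0 < τ * (2 * ε / μ) := by linarith
    exact pos_of_mul_pos_left h1 (by positivity)
  refine ⟨-(μ / τ) • g, ?_, fun u r hur => ?_⟩
  · have h1 : T * g v + τ * ((T * α - 2 * ε) / μ) < 0 := by linarith
    rw [hTβ] at h1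
    have h2 : T * (g v + τ * β / μ) < 0 := by convert h1 using 1; ring
    have h3 : g v + τ * β / μ < 0 := by
      by_contra! h; have := mul_nonneg hT.le h; linarith
    have h4 : (μ / τ) * (g v + τ * β / μ) < 0 := mul_neg_of_pos_of_neg (by positivity) h3
    have h5 : (μ / τ) * (g v + τ * β / μ) = β - (-(μ / τ) • g) v := by
      simp; field_simp; ring
    linarith
  · have h1 := hfE _ hur
    rw [hf] at h1
    have h2 : 0 ≤ (μ / τ) * (g u - g x₀ + τ * (r - r₀ + 2 * ε / μ)) := by
      have : 0 ≤ g u - g x₀ + τ * (r - r₀ + 2 * ε / μ) := by linarith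
      positivity
    have h3 : (μ / τ) * (g u - g x₀ + τ * (r - r₀ + 2 * ε / μ)) =
        μ * (r - r₀) + 2 * ε - (-(μ / τ) • g) (u - x₀) := by
      simp [map_sub]; field_simp; ring
    linarith

end

/-! ### Weak* approximation on finite sets of vectors. -/

/-- A point lies in the weak* closure of a convex set of functionals, tested on finitely many
vectors, if no vector separates it from the set. -/
theorem Convex.exists_forall_mem_finset_abs_sub_lt {X : Type*} [NormedAddCommGroup X]
    [NormedSpace ℝ X] {C : Set (X →L[ℝ] ℝ)} (hC : Convex ℝ C) (ξ : X →L[ℝ] ℝ)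
    (h : ∀ v β, β < ξ v → ∃ η ∈ C, β < η v) (s : Finset X) {δ : ℝ} (hδ : 0 < δ) :
    ∃ η ∈ C, ∀ v ∈ s, |η v - ξ v| < δ := by
  classical
  let T : (X →L[ℝ] ℝ) →ₗ[ℝ] (s → ℝ) :=
    { toFun := fun η v => η v
      map_add' := fun _ _ => rfl
      map_smul' := fun _ _ => rfl }
  have hT : T ξ ∈ closure (T '' C) := by
    by_contra hn
    obtain ⟨f, c, hfC, hfξ⟩ :=
      geometric_hahn_banach_closed_point (hC.linear_image T).closure isClosed_closure hn
    -- A functional on the finite-dimensional image is evaluation at a combination of the vectors of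
    -- `s`, to which `h` applies.
    have key : ∀ η : X →L[ℝ] ℝ, f (T η) = η (∑ i : s, f (fun j => if i = j then 1 else 0) • i.1) := by
      intro η
      have := LinearMap.pi_apply_eq_sum_univ (f : (s → ℝ) →ₗ[ℝ] ℝ) (T η)
      simp only [ContinuousLinearMap.coe_coe] at this
      rw [this, map_sum]
      refine Finset.sum_congr rfl fun i _ => ?_
      simp [T, mul_comm]
    rw [key] at hfξ
    obtain ⟨η, hη, hlt⟩ := h _ _ hfξ
    rw [← key] at hlt
    exact hlt.not_gt (hfC _ (subset_closure ⟨η, hη, rfl⟩))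
  obtain ⟨_, ⟨η, hη, rfl⟩, hd⟩ := Metric.mem_closure_iff.1 hT δ hδ
  refine ⟨η, hη, fun v hv => ?_⟩
  have := (dist_pi_lt_iff hδ).1 hd ⟨v, hv⟩
  rwa [dist_comm, Real.dist_eq] at this

/-- Basic neighbourhoods of the weak* topology. -/
theorem WeakDual.exists_finset_forall_abs_sub_lt {X : Type*} [NormedAddCommGroup X]
    [NormedSpace ℝ X] {ξ : WeakDual ℝ X} {W : Set (WeakDual ℝ X)} (hW : W ∈ 𝓝 ξ) :
    ∃ (s : Finset X) (δ : ℝ), 0 < δ ∧ ∀ η : WeakDual ℝ X, (∀ v ∈ s, |η v - ξ v| < δ) → η ∈ W := by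
  have hind : Topology.IsInducing fun (η : WeakDual ℝ X) (v : X) => η v := ⟨rfl⟩
  rw [hind.nhds_eq_comap, nhds_pi, mem_comap] at hW
  obtain ⟨V, hV, hVW⟩ := hW
  obtain ⟨I, hI, t, ht, htV⟩ := Filter.mem_pi.1 hV
  choose r hr hrt using fun v => Metric.mem_nhds_iff.1 (ht v)
  lift I to Finset X using hI
  obtain ⟨δ, hδ, hδr⟩ : ∃ δ > 0, ∀ v ∈ I, δ ≤ r v := by
    rcases I.eq_empty_or_nonempty with rfl | hne
    · exact ⟨1, one_pos, by simp⟩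
    · exact ⟨I.inf' hne r, (Finset.lt_inf'_iff hne).2 fun v _ => hr v,
        fun v hv => Finset.inf'_le r hv⟩
  refine ⟨I, δ, hδ, fun η hη => hVW (htV fun v hv => hrt v ?_)⟩
  rw [Metric.mem_ball, Real.dist_eq]
  exact (hη v hv).trans_le (hδr v hv)

/-! ### Normals to the sublevel set and scaled subgradients. -/

namespace ConvexSublevel

variable {X : Type*} [NormedAddCommGroup X] [NormedSpace ℝ X]

/-- The epigraph of an extended-real function, in `X × ℝ`. -/
def realEpigraph (Φ : X → EReal) : Set (X × ℝ) := {p | Φ p.1 ≤ (p.2 : EReal)}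

theorem IsGammaZero.isClosed_realEpigraph {Φ : X → EReal} (hΦ : IsGammaZero Φ) :
    IsClosed (realEpigraph Φ) :=
  hΦ.lsc.isClosed_epigraph.preimage
    (continuous_fst.prodMk (continuous_coe_real_ereal.comp continuous_snd))

theorem IsGammaZero.coe_toReal {Φ : X → EReal} (hΦ : IsGammaZero Φ) {x : X}
    (hx : x ∈ effDomain Φ) : ((Φ x).toReal : EReal) = Φ x :=
  EReal.coe_toReal (ne_of_lt hx) (hΦ.ne_bot x)

/-- For `x* = ζ / μ`, membership in `∂Φ(x)` is an inequality on the epigraph. -/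
theorem IsGammaZero.mem_subdiff {Φ : X → EReal} (hΦ : IsGammaZero Φ) {x : X} {r : ℝ}
    (hxr : (x, r) ∈ realEpigraph Φ) {ζ : X →L[ℝ] ℝ}
    (hζ : ∀ u s, (u, s) ∈ realEpigraph Φ → ζ (u - x) ≤ s - r) :
    StrongDual.toWeakDual ζ ∈ subdiff Φ x ∧ (Φ x).toReal = r := by
  have hx : x ∈ effDomain Φ := lt_of_le_of_lt hxr (EReal.coe_lt_top r)
  have hc := hΦ.coe_toReal hx
  have hr : (Φ x).toReal = r := by
    refine le_antisymm ?_ ?_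
    · rw [← EReal.coe_le_coe_iff, hc]; exact hxr
    · have := hζ x (Φ x).toReal hc.ge
      simpa using this
  refine ⟨⟨hx, fun u => ?_⟩, hr⟩
  rw [← hc, hr, StrongDual.toWeakDual_apply]
  by_cases hu : u ∈ effDomain Φ
  · have := hζ u (Φ u).toReal (hΦ.coe_toReal hu).ge
    rw [← hΦ.coe_toReal hu, ← EReal.coe_sub, EReal.coe_le_coe_iff]
    exact this
  · have : Φ u = ⊤ := not_lt_top_iff.1 hu
    simp [this]

/-- Along every ray from `x₀`, a positive multiple of `Φ - Φ x₀` almost dominates any slope below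
that of a normal functional to the sublevel set. -/
theorem IsGammaZero.exists_pos_mul_le_on_ray {Φ : X → EReal} (hΦ : IsGammaZero Φ) {x₀ : X}
    (hx₀ : x₀ ∈ effDomain Φ) {ξ : X →L[ℝ] ℝ} (hξ : ∀ x ∈ sublevel Φ (Φ x₀), ξ (x - x₀) ≤ 0)
    {v : X} {α ε : ℝ} (hα : α < ξ v) (hε : 0 < ε) :
    ∃ μ > 0, ∀ t r, 0 ≤ t → (x₀ + t • v, r) ∈ realEpigraph Φ →
      t * α - ε ≤ μ * (r - (Φ x₀).toReal) := by
  set r₀ := (Φ x₀).toReal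
  have hc : (r₀ : EReal) = Φ x₀ := hΦ.coe_toReal hx₀
  -- Chords from `(x₀, r₀)` stay in the epigraph, so a bound at `t₁` propagates to all `t ≥ t₁`.
  have hscale : ∀ t₁ t r, 0 < t₁ → t₁ ≤ t → (x₀ + t • v, r) ∈ realEpigraph Φ →
      (x₀ + t₁ • v, r₀ + t₁ / t * (r - r₀)) ∈ realEpigraph Φ := by
    intro t₁ t r h1 h2 h
    have ht : 0 < t := h1.trans_le h2
    have := hΦ.convex_epigraph (x := (x₀, r₀)) hc.ge h (a := 1 - t₁ / t) (b := t₁ / t)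
      (sub_nonneg.2 ((div_le_one ht).2 h2)) (by positivity) (by ring)
    change _ ∈ realEpigraph Φ at this
    convert this using 1
    have hv : t₁ • v = (t₁ / t * t) • v := by rw [div_mul_cancel₀ _ ht.ne']
    ext
    · change x₀ + t₁ • v = (1 - t₁ / t) • x₀ + (t₁ / t) • (x₀ + t • v)
      rw [hv]
      module
    · change r₀ + t₁ / t * (r - r₀) = (1 - t₁ / t) * r₀ + t₁ / t * r
      ring
  rcases lt_or_ge 0 (ξ v) with hpos | hneg
  · have habove : ∀ t : ℝ, 0 < t → Φ x₀ < Φ (x₀ + t • v) := by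
      intro t ht
      by_contra! h
      have := hξ (x₀ + t • v) h
      simp only [add_sub_cancel_left, map_smul, smul_eq_mul] at this
      exact this.not_gt (by positivity)
    have hge : ∀ t r : ℝ, 0 ≤ t → (x₀ + t • v, r) ∈ realEpigraph Φ → 0 ≤ r - r₀ := by
      intro t r ht h
      rw [sub_nonneg, ← EReal.coe_le_coe_iff, hc]
      rcases ht.eq_or_lt with rfl | ht
      · simpa [realEpigraph] using h
      · exact (habove t ht).le.trans h
    -- Up to this parameter `t * α - ε ≤ 0`, and `Φ ≥ Φ x₀` suffices; beyond it the chord slope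
    -- takes over.
    have ht₁ : 0 < ε / ξ v := by positivity
    obtain ⟨c', hc1, hc2⟩ := EReal.lt_iff_exists_real_btwn.1 (habove _ ht₁)
    rw [← hc, EReal.coe_lt_coe_iff] at hc1
    refine ⟨ε / (c' - r₀), div_pos hε (sub_pos.2 hc1), fun t r ht h => ?_⟩
    rcases le_total t (ε / ξ v) with htt | htt
    · have h1 : 0 ≤ ε / (c' - r₀) * (r - r₀) :=
        mul_nonneg (div_pos hε (sub_pos.2 hc1)).le (hge t r ht h)
      rw [le_div_iff₀ hpos] at htt
      nlinarith
    · have htpos := ht₁.trans_le htt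
      have h1 : c' ≤ r₀ + ε / ξ v / t * (r - r₀) := by
        rw [← EReal.coe_le_coe_iff]
        exact hc2.le.trans (hscale _ _ _ ht₁ htt h)
      have hcpos := sub_pos.2 hc1
      have h2 : t * ξ v ≤ ε / (c' - r₀) * (r - r₀) := by
        have h3 : c' - r₀ ≤ ε * (r - r₀) / (ξ v * t) := by
          rw [div_div, div_mul_eq_mul_div] at h1; linarith
        rw [le_div_iff₀ (by positivity)] at h3
        rw [div_mul_eq_mul_div, le_div_iff₀ hcpos]
        linarith
      nlinarith
  · have hα0 : α < 0 := hα.trans_le hneg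
    have hev : ∀ᶠ t : ℝ in 𝓝 0, ((r₀ - 1 : ℝ) : EReal) < Φ (x₀ + t • v) := by
      have hcont : Tendsto (fun t : ℝ => x₀ + t • v) (𝓝 0) (𝓝 x₀) := by
        have : Continuous fun t : ℝ => x₀ + t • v := by fun_prop
        simpa using this.tendsto 0
      refine hcont.eventually (hΦ.lsc x₀ _ ?_)
      change ((r₀ - 1 : ℝ) : EReal) < Φ x₀
      rw [← hc, EReal.coe_lt_coe_iff]; linarith
    obtain ⟨d, hd, hball⟩ := Metric.eventually_nhds_iff.1 hev
    have ht₁ : 0 < d / 2 := by positivity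
    have hlow : ∀ t r, 0 ≤ t → t ≤ d / 2 → (x₀ + t • v, r) ∈ realEpigraph Φ → -1 ≤ r - r₀ := by
      intro t r ht htt h
      have := (hball (y := t) (by rw [Real.dist_0_eq_abs, abs_of_nonneg ht]; linarith)).le.trans h
      rw [EReal.coe_le_coe_iff] at this
      linarith
    -- The bound by `ε` handles `t ≤ d / 2`, where `Φ` drops by at most 1; the other handles larger
    -- `t` through the chord slope.
    have hμ : 0 < min ε (-α * (d / 2)) := lt_min hε (by nlinarith)
    refine ⟨_, hμ, fun t r ht h => ?_⟩
    have hμ1 := min_le_left ε (-α * (d / 2))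
    have hμ2 := min_le_right ε (-α * (d / 2))
    set μ := min ε (-α * (d / 2))
    rcases le_total t (d / 2) with htt | htt
    · nlinarith [hlow t r ht htt h]
    · have htpos := ht₁.trans_le htt
      have h1 := hlow _ _ ht₁.le le_rfl (hscale _ _ _ ht₁ htt h)
      rw [add_sub_cancel_left, div_mul_eq_mul_div, le_div_iff₀ htpos] at h1
      have h2 : μ * (-t) ≤ μ * (d / 2 * (r - r₀)) := by gcongr; linarith
      have h3 : d / 2 * (t * α) ≤ d / 2 * (μ * (r - r₀)) := by nlinarith
      linarith [le_of_mul_le_mul_left h3 ht₁]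

/-- Approximate subgradients of positive multiples of `Φ` at `x₀`, as functionals on the epigraph. -/
def approxNormals (Φ : X → EReal) (x₀ : X) (ε : ℝ) : Set (X →L[ℝ] ℝ) :=
  {η | ∃ μ > 0, ∀ u r, (u, r) ∈ realEpigraph Φ → η (u - x₀) ≤ μ * (r - (Φ x₀).toReal) + ε}

/-- Multipliers average along with functionals. They must be free to vary, since the one found on a
ray depends on its direction. -/
theorem convex_approxNormals (Φ : X → EReal) (x₀ : X) (ε : ℝ) :
    Convex ℝ (approxNormals Φ x₀ ε) := by
  rintro η ⟨μ, hμ, h⟩ η' ⟨μ', hμ', h'⟩ a b ha hb hab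
  refine ⟨a * μ + b * μ', ?_, fun u r hur => ?_⟩
  · rcases ha.eq_or_lt with rfl | ha
    · obtain rfl : b = 1 := by linarith
      simpa using hμ'
    · positivity
  · have h1 := mul_le_mul_of_nonneg_left (h u r hur) ha
    have h2 := mul_le_mul_of_nonneg_left (h' u r hur) hb
    simp only [add_apply, smul_apply, smul_eq_mul]
    have : a * ε + b * ε = ε := by rw [← add_mul, hab, one_mul]
    linarith

theorem IsGammaZero.exists_scaled_subgradient_near [CompleteSpace X] {Φ : X → EReal}
    (hΦ : IsGammaZero Φ) {x₀ : X} (hx₀ : x₀ ∈ effDomain Φ) {ξ : X →L[ℝ] ℝ}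
    (hξ : ∀ x ∈ sublevel Φ (Φ x₀), ξ (x - x₀) ≤ 0) (s : Finset X) {δ : ℝ} (hδ : 0 < δ) :
    ∃ (x : X) (μ : ℝ) (ζ : WeakDual ℝ X), 0 ≤ μ ∧ ζ ∈ subdiff Φ x ∧ ‖x - x₀‖ < δ ∧
      |μ * ((Φ x).toReal - (Φ x₀).toReal)| < δ ∧ |μ * ζ (x - x₀)| < δ ∧
      ∀ v ∈ s, |(μ • ζ) v - ξ v| < δ := by
  have hc := hΦ.coe_toReal hx₀
  have h₀ : (x₀, (Φ x₀).toReal) ∈ realEpigraph Φ := hc.ge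
  -- `M` bounds `‖v‖ + |η v|` before `η` is chosen, because `η` will be within `δ` of `ξ` on `s`.
  obtain ⟨M, hM0, hM⟩ : ∃ M > 0, ∀ v ∈ s, ‖v‖ + |ξ v| + δ ≤ M := by
    refine ⟨∑ v ∈ s, (‖v‖ + |ξ v| + δ) + 1, by positivity, fun v hv => ?_⟩
    have := Finset.single_le_sum (f := fun v => ‖v‖ + |ξ v| + δ) (fun i _ => by positivity) hv
    linarith
  obtain ⟨κ, hκ, hκ1, hκδ, hκM⟩ : ∃ κ > 0, κ ≤ 1 ∧ 2 * κ < δ ∧ κ * M < δ / 2 := by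
    refine ⟨min 1 (min (δ / 3) (δ / (3 * M))), by positivity, min_le_left _ _, ?_, ?_⟩
    · have := (min_le_right 1 (min (δ / 3) (δ / (3 * M)))).trans (min_le_left _ _)
      linarith
    · have := (min_le_right 1 (min (δ / 3) (δ / (3 * M)))).trans (min_le_right _ _)
      have h2 := mul_le_mul_of_nonneg_right this hM0.le
      have : δ / (3 * M) * M = δ / 3 := by field_simp
      linarith
  obtain ⟨η, ⟨μ, hμ, hη⟩, hηξ⟩ := (convex_approxNormals Φ x₀ (κ ^ 2))
    |>.exists_forall_mem_finset_abs_sub_lt ξ (fun v β hβ => by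
      obtain ⟨α, hβα, hα⟩ := exists_between hβ
      -- Separation doubles the tolerance, which must end up as `κ ^ 2`.
      have hε : 0 < κ ^ 2 / 2 := by positivity
      obtain ⟨μ, hμ, hray⟩ := hΦ.exists_pos_mul_le_on_ray hx₀ hξ hα hε
      obtain ⟨η, h1, h2⟩ := exists_approx_subgradient_lt hΦ.isClosed_realEpigraph
        hΦ.convex_epigraph h₀ hμ hε hβα hray
      exact ⟨η, ⟨μ, hμ, fun u r hur => by linarith [h2 u r hur]⟩, h1⟩) s (half_pos hδ)
  obtain ⟨x, r, ζ, hxr, hζ, hx, hr, hζx, hζη⟩ := exists_subgradient_near_of_approx_subgradient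
    hΦ.isClosed_realEpigraph hΦ.convex_epigraph h₀ hμ hκ η hη
  obtain ⟨hsub, hΦx⟩ := hΦ.mem_subdiff hxr (ζ := μ⁻¹ • ζ) fun u s hus => by
    rw [smul_apply, smul_eq_mul, inv_mul_le_iff₀ hμ]
    exact hζ u s hus
  have hval : ∀ w, μ * (StrongDual.toWeakDual (μ⁻¹ • ζ)) w = ζ w := fun w => by
    rw [StrongDual.toWeakDual_apply, smul_apply, smul_eq_mul, mul_inv_cancel_left₀ hμ.ne']
  have hκ2 : κ + κ ^ 2 < δ := by nlinarith
  refine ⟨x, μ, _, hμ.le, hsub, by linarith, ?_, ?_, fun v hv => ?_⟩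
  · rw [hΦx]; linarith
  · rw [hval]; linarith
  · change |μ * (StrongDual.toWeakDual (μ⁻¹ • ζ)) v - ξ v| < δ
    rw [hval]
    have h1 := hηξ v hv
    have h2 := hζη v
    have h3 : |η v| ≤ |ξ v| + δ := by
      have := abs_sub_abs_le_abs_sub (η v) (ξ v)
      linarith
    have h4 : κ * (‖v‖ + |η v|) ≤ κ * M := by
      gcongr; linarith [hM v hv]
    have h5 := abs_sub_le (ζ v) (η v) (ξ v)
    linarith

theorem exists_forall_mem_of_mem_approach (Φ : X → EReal) (x₀ : X) {Z : Set (X × ℝ × WeakDual ℝ X)}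
    (hZ : Z ∈ approach Φ x₀) : ∃ δ > 0, ∀ x μ ζ, 0 ≤ μ → ζ ∈ subdiff Φ x → ‖x - x₀‖ < δ →
      |μ * ((Φ x).toReal - (Φ x₀).toReal)| < δ → |μ * ζ (x - x₀)| < δ → (x, μ, ζ) ∈ Z := by
  rw [approach, mem_inf_principal, ((Metric.nhds_basis_ball.comap _).inf
    (Metric.nhds_basis_ball.comap _) |>.inf (Metric.nhds_basis_ball.comap _)).mem_iff] at hZ
  obtain ⟨⟨⟨a, b⟩, c⟩, ⟨⟨ha, hb⟩, hc⟩, h⟩ := hZ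
  simp only at ha hb hc
  refine ⟨min a (min b c), by positivity, fun x μ ζ hμ hζ h1 h2 h3 => h ⟨⟨?_, ?_⟩, ?_⟩ ⟨hμ, hζ⟩⟩
  · simpa [dist_eq_norm] using h1.trans_le (min_le_left _ _)
  · simpa using h2.trans_le ((min_le_right _ _).trans (min_le_left _ _))
  · simpa using h3.trans_le ((min_le_right _ _).trans (min_le_right _ _))

/-- Norm convergence is left out: the inclusion of the upper limit in the normal cone needs only the
two scalar limits. -/
theorem approach_mem (Φ : X → EReal) (x₀ : X) {δ : ℝ} (hδ : 0 < δ) :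
    {p : X × ℝ × WeakDual ℝ X | 0 ≤ p.2.1 ∧ p.2.2 ∈ subdiff Φ p.1 ∧
      |p.2.1 * ((Φ p.1).toReal - (Φ x₀).toReal)| < δ ∧ |p.2.1 * p.2.2 (p.1 - x₀)| < δ} ∈
      approach Φ x₀ := by
  have h1 : ∀ᶠ p in approach Φ x₀, p.2.1 * ((Φ p.1).toReal - (Φ x₀).toReal) ∈ Metric.ball 0 δ :=
    (tendsto_comap.mono_left (inf_le_left.trans (inf_le_left.trans inf_le_right))).eventually
      (Metric.ball_mem_nhds 0 hδ)
  have h2 : ∀ᶠ p in approach Φ x₀, p.2.1 * p.2.2 (p.1 - x₀) ∈ Metric.ball 0 δ :=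
    (tendsto_comap.mono_left (inf_le_left.trans inf_le_right)).eventually
      (Metric.ball_mem_nhds 0 hδ)
  have h3 : ∀ᶠ p in approach Φ x₀, 0 ≤ p.2.1 ∧ p.2.2 ∈ subdiff Φ p.1 :=
    (inf_le_right : approach Φ x₀ ≤ _) (mem_principal_self _)
  filter_upwards [h1, h2, h3] with p h1 h2 h3
  exact ⟨h3.1, h3.2, by simpa using h1, by simpa using h2⟩

end ConvexSublevel

theorem corollary4p5 {X : Type*} [NormedAddCommGroup X] [NormedSpace ℝ X] [CompleteSpace X]
    (Φ : X → EReal) (hΦ : ConvexSublevel.IsGammaZero Φ)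
    (xbar : X) (hx : xbar ∈ ConvexSublevel.effDomain Φ) :
    ConvexSublevel.normalCone (ConvexSublevel.sublevel Φ (Φ xbar)) xbar =
      ConvexSublevel.upperLimit (ConvexSublevel.approach Φ xbar)
        (fun p : X × ℝ × WeakDual ℝ X => {p.2.1 • p.2.2}) := by
  apply Set.Subset.antisymm
  · intro ξ hξ W hW Z hZ
    obtain ⟨s, δ, hδ, hs⟩ := WeakDual.exists_finset_forall_abs_sub_lt hW
    obtain ⟨δ', hδ', hZ'⟩ := ConvexSublevel.exists_forall_mem_of_mem_approach Φ xbar hZ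
    obtain ⟨x, μ, ζ, hμ, hζ, h1, h2, h3, h4⟩ := hΦ.exists_scaled_subgradient_near hx
      (ξ := WeakDual.toStrongDual ξ) hξ s (lt_min hδ hδ')
    refine ⟨(x, μ, ζ), hZ' x μ ζ hμ hζ (h1.trans_le (min_le_right _ _))
      (h2.trans_le (min_le_right _ _)) (h3.trans_le (min_le_right _ _)), μ • ζ, rfl,
      hs _ fun v hv => (h4 v hv).trans_le (min_le_left _ _)⟩
  · intro ξ hξ u hu
    refine le_of_forall_pos_lt_add fun ε hε => ?_
    -- One third of `ε` each for the weak* error and the two scalar limits.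
    have hW : {η : WeakDual ℝ X | |η (u - xbar) - ξ (u - xbar)| < ε / 3} ∈ 𝓝 ξ :=
      (isOpen_lt (((WeakDual.eval_continuous _).sub continuous_const).abs)
        continuous_const).mem_nhds (by simpa using by positivity)
    obtain ⟨⟨x, μ, ζ⟩, ⟨hμ, ⟨hxd, hζ⟩, h1, h2⟩, _, rfl, h3⟩ :=
      hξ _ hW _ (ConvexSublevel.approach_mem Φ xbar (by positivity : 0 < ε / 3))
    simp only at hμ hζ h1 h2
    have hud : u ∈ ConvexSublevel.effDomain Φ :=
      lt_of_le_of_lt (b := Φ xbar) hu hx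
    have hux : (Φ u).toReal ≤ (Φ xbar).toReal :=
      EReal.toReal_le_toReal hu (hΦ.ne_bot u) (ne_of_lt hx)
    have h4 := hζ u
    rw [← hΦ.coe_toReal hud, ← hΦ.coe_toReal hxd, ← EReal.coe_sub, EReal.coe_le_coe_iff] at h4
    have h5 : μ * ζ (u - x) ≤ μ * ((Φ xbar).toReal - (Φ x).toReal) := by gcongr; linarith
    have h6 : |μ * ζ (u - xbar) - ξ (u - xbar)| < ε / 3 := h3
    rw [abs_lt] at h1 h2 h6
    have h7 : ζ (u - xbar) = ζ (u - x) + ζ (x - xbar) := by rw [← map_add, sub_add_sub_cancel]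
    rw [h7] at h6
    linarith
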